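/- Call a continuous non-decreasing function $g\colon[0,\infty)\to[0,\infty)$ regular if $g(0)=0$ and, for some fixed $c>1$, $g(x)\asymp g(cx)$, i.e. there is $C$ with $g(x)\le C\,g(cx)$ and $g(cx)\le C\,g(x)$ for all $x\ge 0$; put $g(\infty)=\lim_{x\to\infty}g(x)\in[0,\infty]$. For regular $f$ let $\Lambda_f$ be the $f$-Hausdorff measure on $\mathbb{R}^d$, $$\Lambda_f(A)=\lim_{\delta\to0}\ \inf\Big\{\sum_j f(\operatorname{diam}B_j)\ :\ A\subset\bigcup_j B_j,\ \operatorname{diam}(B_j)<\delta\Big\},$$ the infimum being over countable coverings. Let $f,g$ be regular, and let $\varphi\colon\mathbb{R}^d\to\mathbb{R}$ be bounded, radially symmetric and radially non-increasing, with $B_3(0)\subset\operatorname{supp}\varphi$. Let $\psi\colon\mathbb{R}^d\to\mathbb{R}$ be Borel measurable and equivalent to $\varphi$, i.e. $\varphi\le C\psi$ and $\psi\le C\varphi$ pointwise for some constant $C>0$. For a finite signed Borel measure $\mu$ on $\mathbb{R}^d$ and $K\ge0$ consider the condition $$(\ast)_K\qquad \sum_{B_{r}(x)\in\mathfrak{B}}\left|\int_{\mathbb{R}^d}\psi\Big(\frac{y-x}{r}\Big)\,d\mu(y)\right|\le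 K\,g\Big(\sum_{B_{r}(x)\in\mathfrak{B}}f(r)\Big)\quad\text{for every family }\mathfrak{B}\text{ of pairwise disjoint open balls.}$$ 1. If $|\varphi(x)|=O(f(|x|^{-1}))$ as $x\to\infty$, then every $\mu$ that satisfies $(\ast)_K$ for some $K$ is absolutely continuous with respect to $\Lambda_f$. 2. If $|\varphi(x)|=o(f(|x|^{-1}))$ as $x\to\infty$, then for every $K$ there is a constant $C$, depending only on $d,f,g,\varphi,\psi,K$, such that for every $\mu$ that satisfies $(\ast)_K$ $$|\mu|(A)\le C\,g(\Lambda_f(A))\quad\text{for all Borel sets }A\subset\mathbb{R}^d\text{ with }\Lambda_f(A)<\infty.$$ If moreover $g\not\equiv0$, then for every $\mu$ that satisfies $(\ast)_K$ for some $K$ there is a constant $C$ (possibly depending on $\mu$) such that $|\mu|(A)\le C\,g(\Lambda_f(A))$ for all Borel sets $A$, including those with $\Lambda_f(A)=\infty$. -/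

import Mathlib

open MeasureTheory Asymptotics
open scoped NNReal ENNReal

noncomputable section

/-- A function `g : [0, ∞) → [0, ∞)` is regular if it is continuous and non-decreasing, `g 0 = 0`,
and `g x ≍ g (c x)` for some fixed `c > 1`. -/
structure IsRegularWeight (g : ℝ≥0 → ℝ≥0) : Prop where
  continuous : Continuous g
  map_zero : g 0 = 0
  monotone : Monotone g
  doubling : ∃ c : ℝ≥0, 1 < c ∧ ∃ C : ℝ≥0, ∀ x, g x ≤ C * g (c * x) ∧ g (c * x) ≤ C * g x

/-- The extension of a non-decreasing `g : [0, ∞) → [0, ∞)` to `[0, ∞]`, with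
`g ∞ = sup g = lim_{x → ∞} g x`. -/
def extendTop (g : ℝ≥0 → ℝ≥0) (t : ℝ≥0∞) : ℝ≥0∞ :=
  if t = ⊤ then ⨆ x : ℝ≥0, (g x : ℝ≥0∞) else (g t.toNNReal : ℝ≥0∞)

/-- The `f`-Hausdorff measure `Λ_f(A) = lim_{δ → 0} inf ∑ f (diam B_j)`, the infimum being over the
countable coverings of `A` by sets of diameter at most `δ` (see `Measure.mkMetric_apply`). -/
def weightedHausdorff (d : ℕ) (f : ℝ≥0 → ℝ≥0) : Measure (EuclideanSpace ℝ (Fin d)) :=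
  Measure.mkMetric (extendTop f)

/-- `φ` is radially symmetric and radially non-increasing. -/
structure IsRadiallyNonincreasing {d : ℕ} (φ : EuclideanSpace ℝ (Fin d) → ℝ) : Prop where
  radial : ∀ x y, ‖x‖ = ‖y‖ → φ x = φ y
  nonincreasing : ∀ x y, ‖x‖ ≤ ‖y‖ → φ y ≤ φ x

/-- `φ ≍ ψ`: each function is pointwise bounded by a constant multiple of the other. -/
def EquivalentFun {d : ℕ} (φ ψ : EuclideanSpace ℝ (Fin d) → ℝ) : Prop :=
  ∃ C : ℝ, 0 < C ∧ ∀ x, φ x ≤ C * ψ x ∧ ψ x ≤ C * φ x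

/-- A family of open balls of positive radii, given by the pairs (centre, radius), no two of which
intersect. -/
structure IsDisjointBallFamily {d : ℕ} (𝔅 : Set (EuclideanSpace ℝ (Fin d) × ℝ≥0)) : Prop where
  radius_pos : ∀ b ∈ 𝔅, 0 < b.2
  disjoint : 𝔅.PairwiseDisjoint fun b => Metric.ball b.1 (b.2 : ℝ)

/-- The smoothed Frostman condition with constant `K`: for every disjoint family `𝔅` of balls
`B_r(x)`, `∑ |∫ ψ ((y - x) / r) dμ(y)| ≤ K * g (∑ f r)`, the sums being over `𝔅`. -/
def FrostmanCondition {d : ℕ} (f g : ℝ≥0 → ℝ≥0) (ψ : EuclideanSpace ℝ (Fin d) → ℝ) (K : ℝ≥0)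
    (μ : SignedMeasure (EuclideanSpace ℝ (Fin d))) : Prop :=
  ∀ 𝔅 : Set (EuclideanSpace ℝ (Fin d) × ℝ≥0), IsDisjointBallFamily 𝔅 →
    ∑' b : 𝔅, ENNReal.ofReal |∫ᵛ y, ψ ((b.1.2 : ℝ)⁻¹ • (y - b.1.1)) ∂<•μ| ≤
      K * extendTop g (∑' b : 𝔅, (f b.1.2 : ℝ≥0∞))

end

section

open Metric Filter Topology Set

/-! ### Regular weights -/

/-! Write `μ = p - q` in Jordan decomposition. Since `p` and `q` are mutually singular,
differentiation of measures shows that about `p`-almost every point `q` is at most `ε` times `p` on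
all balls of radius at most some `δ`. There cancellation is harmless: a radially non-increasing
kernel is a superposition of concentric balls, so the part of its `q`-integral within distance `δ`
is at most `ε` times its `p`-integral and can be absorbed. The part farther out is at most `Φ (δ /
r) * q univ`, where `Φ` is the radial profile of `φ`. Hence the `p`-mass of a `5/2`-enlarged ball is
controlled by the smoothed integral of `μ` plus this tail (`measureReal_closedBall_le`).

A set of finite `Λ_f`-measure is efficiently covered by `5/2`-enlargements of small disjoint balls
centred in it (`IsRegularWeight.exists_hasDisjointCovers`). Summing over them, the Frostman
condition bounds the main terms by `g`, and the decay of `φ` bounds the tails by `κ Cδ ∑ f r`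
(`measure_le_of_forall_closedBall_le`). Under `O` both terms vanish on null sets. Under `o`, with
`δ` fixed, letting `κ → 0` removes every quantity that depends on `δ` or `μ`. An exhaustion by sets
with uniform `δ` (`measure_le_of_forall_uniform`) and the exchange of `p` and `q` finish the proof.
-/

theorem IsRegularWeight.exists_map_mul_le {f : ℝ≥0 → ℝ≥0} (hf : IsRegularWeight f) (L : ℝ≥0) :
    ∃ C : ℝ≥0, ∀ x, f (L * x) ≤ C * f x := by
  obtain ⟨c, hc, C, hC⟩ := hf.doubling
  have key : ∀ n : ℕ, ∀ x, f (c ^ n * x) ≤ C ^ n * f x := by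
    intro n
    induction n with
    | zero => simp
    | succ n ih =>
      intro x
      calc f (c ^ (n + 1) * x) = f (c ^ n * (c * x)) := by ring_nf
        _ ≤ C ^ n * f (c * x) := ih _
        _ ≤ C ^ n * (C * f x) := by gcongr; exact (hC x).2
        _ = C ^ (n + 1) * f x := by ring
  obtain ⟨n, hn⟩ := pow_unbounded_of_one_lt L hc
  exact ⟨C ^ n, fun x => (hf.monotone (by gcongr)).trans (key n x)⟩

@[simp]
theorem extendTop_coe (g : ℝ≥0 → ℝ≥0) (x : ℝ≥0) : extendTop g (x : ℝ≥0∞) = g x := by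
  simp [extendTop]

theorem extendTop_top (g : ℝ≥0 → ℝ≥0) : extendTop g ⊤ = ⨆ x : ℝ≥0, (g x : ℝ≥0∞) := by
  simp [extendTop]

theorem extendTop_mono {g : ℝ≥0 → ℝ≥0} (hg : Monotone g) : Monotone (extendTop g) := by
  intro a b hab
  induction b with
  | top =>
    induction a with
    | top => rfl
    | coe a => rw [extendTop_coe, extendTop_top]; exact le_iSup (fun x => (g x : ℝ≥0∞)) a
  | coe b =>
    lift a to ℝ≥0 using ne_top_of_le_ne_top ENNReal.coe_ne_top hab
    rw [extendTop_coe, extendTop_coe]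
    exact_mod_cast hg (by exact_mod_cast hab)

/-! ### Integrals against signed measures -/

theorem SignedMeasure.integral_eq_sub {X : Type*} [MeasurableSpace X] (μ : SignedMeasure X)
    {h : X → ℝ} (hm : Measurable h) {M : ℝ} (hM : ∀ x, |h x| ≤ M) :
    ∫ᵛ y, h y ∂<•μ = ∫ y, h y ∂μ.toJordanDecomposition.posPart -
      ∫ y, h y ∂μ.toJordanDecomposition.negPart := by
  have hint : ∀ ν : Measure X, IsFiniteMeasure ν → Integrable h ν := fun ν _ =>
    Integrable.of_bound hm.aestronglyMeasurable M (ae_of_all _ hM)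
  conv_lhs => rw [← SignedMeasure.toSignedMeasure_toJordanDecomposition μ]
  rw [JordanDecomposition.toSignedMeasure, VectorMeasure.integral_sub_vectorMeasure,
    VectorMeasure.integral_toSignedMeasure, VectorMeasure.integral_toSignedMeasure]
  all_goals
    simp only [VectorMeasure.Integrable, Measure.variation_toSignedMeasure]
    exact hint _ inferInstance

/-- The smoothed Frostman condition for the difference `p - q` of two finite measures, for
families of balls indexed by sets of natural numbers. -/
def PairFrostman {d : ℕ} (f g : ℝ≥0 → ℝ≥0) (ψ : EuclideanSpace ℝ (Fin d) → ℝ) (K : ℝ≥0)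
    (p q : Measure (EuclideanSpace ℝ (Fin d))) : Prop :=
  ∀ (u : Set ℕ) (x : ℕ → EuclideanSpace ℝ (Fin d)) (r : ℕ → ℝ≥0), (∀ n ∈ u, 0 < r n) →
    u.PairwiseDisjoint (fun n => ball (x n) (r n : ℝ)) →
    ∑' n : u, ENNReal.ofReal |∫ y, ψ ((r n : ℝ)⁻¹ • (y - x n)) ∂p -
        ∫ y, ψ ((r n : ℝ)⁻¹ • (y - x n)) ∂q| ≤
      K * extendTop g (∑' n : u, (f (r n) : ℝ≥0∞))

theorem PairFrostman.symm {d : ℕ} {f g : ℝ≥0 → ℝ≥0} {ψ : EuclideanSpace ℝ (Fin d) → ℝ} {K : ℝ≥0}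
    {p q : Measure (EuclideanSpace ℝ (Fin d))} (h : PairFrostman f g ψ K p q) :
    PairFrostman f g ψ K q p := by
  intro u x r hr hu
  simpa only [abs_sub_comm] using h u x r hr hu

theorem FrostmanCondition.pairFrostman {d : ℕ} {f g : ℝ≥0 → ℝ≥0}
    {ψ : EuclideanSpace ℝ (Fin d) → ℝ} {K : ℝ≥0} {μ : SignedMeasure (EuclideanSpace ℝ (Fin d))}
    (h : FrostmanCondition f g ψ K μ) (hψ : Measurable ψ) {M : ℝ} (hM : ∀ x, |ψ x| ≤ M) :
    PairFrostman f g ψ K μ.toJordanDecomposition.posPart μ.toJordanDecomposition.negPart := by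
  intro u x r hr hu
  set b : ℕ → EuclideanSpace ℝ (Fin d) × ℝ≥0 := fun n => (x n, r n)
  -- Equal balls at distinct indices would be disjoint from themselves, hence empty.
  have hinj : InjOn b u := by
    intro m hm n hn hmn
    by_contra hne
    have := hu hm hn hne
    simp only [b, Prod.mk.injEq] at hmn
    rw [Function.onFun, hmn.1, hmn.2, disjoint_self] at this
    exact (nonempty_ball.2 (NNReal.coe_pos.2 (hr n hn))).ne_empty this
  have hfam : IsDisjointBallFamily (b '' u) := by
    refine ⟨by rintro _ ⟨n, hn, rfl⟩; exact hr n hn, ?_⟩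
    rintro _ ⟨m, hm, rfl⟩ _ ⟨n, hn, rfl⟩ hne
    exact hu hm hn (fun e => hne (by rw [e]))
  have := h _ hfam
  rw [tsum_image (fun c : EuclideanSpace ℝ (Fin d) × ℝ≥0 =>
      ENNReal.ofReal |∫ᵛ y, ψ ((c.2 : ℝ)⁻¹ • (y - c.1)) ∂<•μ|) hinj,
    tsum_image (fun c : EuclideanSpace ℝ (Fin d) × ℝ≥0 => (f c.2 : ℝ≥0∞)) hinj] at this
  refine le_trans (le_of_eq ?_) this
  refine tsum_congr fun n => ?_
  rw [SignedMeasure.integral_eq_sub μ (M := M) (by fun_prop) (fun y => hM _)]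

/-- In dimension 0 there are no vectors of prescribed norm, so no radial profile. But a single ball
of radius `r` already gives `|ψ 0 * μ univ| ≤ K g (f r)`, which tends to 0 with `r`. -/
theorem FrostmanCondition.eq_zero_of_subsingleton {f g : ℝ≥0 → ℝ≥0} (hf : IsRegularWeight f)
    (hg : IsRegularWeight g) {ψ : EuclideanSpace ℝ (Fin 0) → ℝ} (hψ : ψ 0 ≠ 0) {K : ℝ≥0}
    {μ : SignedMeasure (EuclideanSpace ℝ (Fin 0))} (h : FrostmanCondition f g ψ K μ) : μ = 0 := by
  have h1 : ∀ r : ℝ≥0, 0 < r →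
      ENNReal.ofReal |ψ 0 * μ univ| ≤ ((K * g (f r) : ℝ≥0) : ℝ≥0∞) := by
    intro r hr
    have := h {((0 : EuclideanSpace ℝ (Fin 0)), r)} ⟨by simpa using hr, by simp⟩
    rw [tsum_singleton (0, r) (fun c : EuclideanSpace ℝ (Fin 0) × ℝ≥0 =>
      ENNReal.ofReal |∫ᵛ y, ψ ((c.2 : ℝ)⁻¹ • (y - c.1)) ∂<•μ|),
      tsum_singleton (0, r) (fun c : EuclideanSpace ℝ (Fin 0) × ℝ≥0 => (f c.2 : ℝ≥0∞)),
      extendTop_coe] at this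
    refine le_trans (le_of_eq ?_) (this.trans_eq (by push_cast; rfl))
    have e : (fun y : EuclideanSpace ℝ (Fin 0) => ψ ((r : ℝ)⁻¹ • (y - 0))) = fun _ => ψ 0 := by
      funext y; congr 1; exact Subsingleton.elim _ _
    simp only [e]
    rw [SignedMeasure.integral_eq_sub μ (M := |ψ 0|) measurable_const (fun _ => le_rfl)]
    conv_lhs => rw [← SignedMeasure.toSignedMeasure_toJordanDecomposition μ]
    rw [JordanDecomposition.toSignedMeasure, Measure.toSignedMeasure_sub_apply MeasurableSet.univ]
    simp only [integral_const, smul_eq_mul]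
    ring_nf
  have h2 : Tendsto (fun r : ℝ≥0 => ((K * g (f r) : ℝ≥0) : ℝ≥0∞)) (𝓝[>] 0) (𝓝 0) := by
    have hc : Continuous fun r : ℝ≥0 => ((K * g (f r) : ℝ≥0) : ℝ≥0∞) :=
      ENNReal.continuous_coe.comp (continuous_const.mul (hg.continuous.comp hf.continuous))
    have := (hc.tendsto 0).mono_left (nhdsWithin_le_nhds (s := Ioi 0))
    simpa [hf.map_zero, hg.map_zero] using this
  have h3 : ENNReal.ofReal |ψ 0 * μ univ| ≤ 0 :=
    ge_of_tendsto h2 (by filter_upwards [self_mem_nhdsWithin] with r hr using h1 r hr)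
  have h4 : μ univ = 0 := by
    have : ψ 0 = 0 ∨ μ univ = 0 := by simpa using h3
    exact this.resolve_left hψ
  ext s hs
  rcases s.eq_empty_or_nonempty with rfl | hne
  · simp
  · rw [hne.eq_univ, h4]; simp

/-! ### Comparison of radial integrals -/

/-- Such an `S` is either a closed ball about `x` or an increasing union of closed balls, according
to whether the supremum of the distances to `x` is attained. -/
theorem measure_le_mul_of_closedBall {X : Type*} [MetricSpace X] [MeasurableSpace X]
    {p q : Measure X} {x : X} {δ : ℝ} {ε : ℝ≥0∞}
    (h : ∀ s, 0 ≤ s → s ≤ δ → q (closedBall x s) ≤ ε * p (closedBall x s))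
    {S : Set X} (hS : S ⊆ closedBall x δ) (hS' : ∀ y ∈ S, closedBall x (dist y x) ⊆ S) :
    q S ≤ ε * p S := by
  rcases S.eq_empty_or_nonempty with rfl | hne
  · simp
  set D : Set ℝ := (fun y => dist y x) '' S
  have hD : BddAbove D := ⟨δ, by rintro _ ⟨y, hy, rfl⟩; exact hS hy⟩
  obtain ⟨v, hv, hvt, hvD⟩ := exists_seq_tendsto_sSup (hne.image _) hD
  have hle : ∀ n, closedBall x (v n) ⊆ S := by
    intro n
    obtain ⟨y, hy, hyn⟩ := hvD n
    simpa only [← hyn] using hS' y hy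
  have hmem : ∀ s ∈ D, q (closedBall x s) ≤ ε * p (closedBall x s) := by
    rintro _ ⟨y, hy, rfl⟩
    exact h _ dist_nonneg (hS hy)
  by_cases hmax : sSup D ∈ D
  · have : S = closedBall x (sSup D) := by
      apply Subset.antisymm
      · exact fun y hy => le_csSup hD ⟨y, hy, rfl⟩
      · obtain ⟨y, hy, hys⟩ := hmax
        simpa only [← hys] using hS' y hy
    rw [this]
    exact hmem _ hmax
  · have hU : S = ⋃ n, closedBall x (v n) := by
      apply Subset.antisymm _ (iUnion_subset hle)
      intro y hy
      have hlt : dist y x < sSup D := lt_of_le_of_ne (le_csSup hD ⟨y, hy, rfl⟩)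
        fun e => hmax (e ▸ ⟨y, hy, rfl⟩)
      obtain ⟨n, hn⟩ := (hvt.eventually (lt_mem_nhds hlt)).exists
      exact mem_iUnion.2 ⟨n, hn.le⟩
    have hmono : Monotone fun n => closedBall x (v n) :=
      fun m n hmn => closedBall_subset_closedBall (hv hmn)
    conv_lhs => rw [hU, hmono.measure_iUnion]
    exact iSup_le fun n => (hmem _ (hvD n)).trans (by gcongr; exact hle n)

/-- Layer cake: the superlevel sets of the integrand inside `closedBall x δ` are unions of balls
about `x`. -/
theorem lintegral_radial_le {X : Type*} [MetricSpace X] [MeasurableSpace X] [BorelSpace X]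
    {p q : Measure X} {x : X} {δ : ℝ} {ε : ℝ≥0}
    (h : ∀ s, 0 ≤ s → s ≤ δ → q (closedBall x s) ≤ ε * p (closedBall x s))
    {Φ : ℝ → ℝ} (hΦ : Antitone Φ) (hΦ0 : ∀ t, 0 ≤ Φ t) :
    ∫⁻ y in closedBall x δ, ENNReal.ofReal (Φ (dist y x)) ∂q ≤
      ε * ∫⁻ y in closedBall x δ, ENNReal.ofReal (Φ (dist y x)) ∂p := by
  have hm : Measurable fun y => Φ (dist y x) :=
    hΦ.measurable.comp (continuous_id.dist continuous_const).measurable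
  rw [lintegral_eq_lintegral_meas_lt _ (ae_of_all _ fun y => hΦ0 _) hm.aemeasurable,
    lintegral_eq_lintegral_meas_lt _ (ae_of_all _ fun y => hΦ0 _) hm.aemeasurable]
  rw [← lintegral_const_mul' _ _ ENNReal.coe_ne_top]
  refine lintegral_mono fun t => ?_
  have hms : MeasurableSet {y | t < Φ (dist y x)} := measurableSet_lt measurable_const hm
  rw [Measure.restrict_apply hms, Measure.restrict_apply hms]
  refine measure_le_mul_of_closedBall h inter_subset_right fun y hy z hz => ?_
  exact ⟨lt_of_lt_of_le hy.1 (hΦ (mem_closedBall.1 hz)),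
    mem_closedBall.2 (le_trans (mem_closedBall.1 hz) (mem_closedBall.1 hy.2))⟩

/-- A measure singular to `p` is negligible on small balls about `p`-almost every point. -/
theorem ae_exists_closedBall_le {d : ℕ} {p q : Measure (EuclideanSpace ℝ (Fin d))}
    [IsFiniteMeasure p] [IsFiniteMeasure q] (hqp : q ⟂ₘ p) {ε : ℝ≥0} (hε : 0 < ε) :
    ∀ᵐ x ∂p, ∃ δ > (0 : ℝ), ∀ s, 0 ≤ s → s ≤ δ →
      q (closedBall x s) ≤ ε * p (closedBall x s) := by
  -- Radius 0 must be included, since a superlevel set of the kernel may be `{x}`; differentiation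
  -- only covers positive radii.
  have h0 : ∀ᵐ x ∂p, q {x} = 0 := by
    obtain ⟨o, _, ho, hoc⟩ := hqp
    filter_upwards [measure_eq_zero_iff_ae_notMem.1 hoc] with x hx
    exact measure_mono_null (by simpa using hx) ho
  filter_upwards [(Besicovitch.vitaliFamily p).ae_eventually_measure_zero_of_singular hqp, h0]
    with x hx hx0
  have h1 := (hx.comp (Besicovitch.tendsto_filterAt p x)).eventually
    (gt_mem_nhds (show (0 : ℝ≥0∞) < ε by exact_mod_cast hε))
  obtain ⟨δ, hδ, hδs⟩ := mem_nhdsGT_iff_exists_Ioc_subset.1 h1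
  refine ⟨δ, hδ, fun s hs0 hs => ?_⟩
  rcases hs0.eq_or_lt with rfl | hs0
  · simp [hx0]
  · have h2 : q (closedBall x s) / p (closedBall x s) < ε := hδs ⟨hs0, hs⟩
    refine (ENNReal.div_le_iff_le_mul (Or.inr ENNReal.coe_ne_top) ?_).1 h2.le
    exact Or.inl (measure_ne_top _ _)

/-! ### The estimate for a single ball -/

/-- With `F` the rescaled profile and `I` the difference of the `ψ`-integrals, `∫ F ∂p ≤ C |I| + C²
∫ F ∂q`. Splitting the last integral at distance `δ`, its near part contributes at most `C² ε ∫ F ∂p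
≤ ½ ∫ F ∂p`, which moves to the left. -/
theorem measureReal_closedBall_le {d : ℕ} {p q : Measure (EuclideanSpace ℝ (Fin d))}
    [IsFiniteMeasure p] [IsFiniteMeasure q] {Φ : ℝ → ℝ} (hΦ : Antitone Φ) (hΦ0 : ∀ t, 0 ≤ Φ t)
    {ψ : EuclideanSpace ℝ (Fin d) → ℝ} (hψ : Measurable ψ) {C : ℝ} (hC : 0 < C)
    (hΦψ : ∀ x, Φ ‖x‖ ≤ C * ψ x ∧ ψ x ≤ C * Φ ‖x‖)
    {x : EuclideanSpace ℝ (Fin d)} {δ : ℝ} {ε : ℝ≥0} (hε : C ^ 2 * ε ≤ 1 / 2)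
    (h : ∀ s, 0 ≤ s → s ≤ δ → q (closedBall x s) ≤ ε * p (closedBall x s))
    {r : ℝ} (hr : 0 < r) (ρ : ℝ) :
    Φ ρ * p.real (closedBall x (ρ * r)) ≤
      2 * C * |∫ y, ψ (r⁻¹ • (y - x)) ∂p - ∫ y, ψ (r⁻¹ • (y - x)) ∂q| +
        2 * C ^ 2 * q.real univ * Φ (δ / r) := by
  set F : EuclideanSpace ℝ (Fin d) → ℝ := fun y => Φ (dist y x / r)
  have hΦr : Antitone fun t => Φ (t / r) := fun a b hab => hΦ (by gcongr)
  have hFm : Measurable F :=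
    hΦr.measurable.comp (continuous_id.dist continuous_const).measurable
  have hF0 : ∀ y, 0 ≤ F y := fun y => hΦ0 _
  have hFb : ∀ y, F y ≤ Φ 0 := fun y => hΦ (by positivity)
  have hFi : ∀ ν : Measure (EuclideanSpace ℝ (Fin d)), IsFiniteMeasure ν → Integrable F ν :=
    fun ν _ => Integrable.of_bound hFm.aestronglyMeasurable (Φ 0)
      (ae_of_all _ fun y => by rw [Real.norm_of_nonneg (hF0 y)]; exact hFb y)
  have hnorm : ∀ y, ‖r⁻¹ • (y - x)‖ = dist y x / r := by
    intro y
    rw [norm_smul, norm_inv, Real.norm_of_nonneg hr.le, dist_eq_norm, inv_mul_eq_div]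
  set G : EuclideanSpace ℝ (Fin d) → ℝ := fun y => ψ (r⁻¹ • (y - x))
  have hGm : Measurable G := by fun_prop
  have hFG : ∀ y, F y ≤ C * G y := fun y => by
    simpa only [hnorm] using (hΦψ (r⁻¹ • (y - x))).1
  have hGF : ∀ y, G y ≤ C * F y := fun y => by
    simpa only [hnorm] using (hΦψ (r⁻¹ • (y - x))).2
  have hG0 : ∀ y, 0 ≤ G y := fun y => by
    have := (hF0 y).trans (hFG y)
    exact nonneg_of_mul_nonneg_right this hC
  have hGi : ∀ ν : Measure (EuclideanSpace ℝ (Fin d)), IsFiniteMeasure ν → Integrable G ν :=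
    fun ν hν => ((hFi ν hν).const_mul C).mono' hGm.aestronglyMeasurable
      (ae_of_all _ fun y => by rw [Real.norm_of_nonneg (hG0 y)]; exact hGF y)
  have h1 : ∫ y, F y ∂p ≤ C * ∫ y, G y ∂p := by
    rw [← integral_const_mul]
    exact integral_mono (hFi p inferInstance) ((hGi p inferInstance).const_mul C) hFG
  have h2 : ∫ y, G y ∂q ≤ C * ∫ y, F y ∂q := by
    rw [← integral_const_mul]
    exact integral_mono (hGi q inferInstance) ((hFi q inferInstance).const_mul C) hGF
  have h3 : ∫ y in closedBall x δ, F y ∂q ≤ ε * ∫ y in closedBall x δ, F y ∂p := by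
    have := lintegral_radial_le h hΦr (fun t => hΦ0 _)
    rw [← ofReal_integral_eq_lintegral_ofReal (hFi q inferInstance).integrableOn
        (ae_of_all _ hF0),
      ← ofReal_integral_eq_lintegral_ofReal (hFi p inferInstance).integrableOn
        (ae_of_all _ hF0), ← ENNReal.ofReal_coe_nnreal, ← ENNReal.ofReal_mul ε.coe_nonneg] at this
    exact (ENNReal.ofReal_le_ofReal_iff
      (mul_nonneg ε.coe_nonneg (integral_nonneg hF0))).1 this
  have h4 : ∫ y in closedBall x δ, F y ∂p ≤ ∫ y, F y ∂p :=
    setIntegral_le_integral (hFi p inferInstance) (ae_of_all _ hF0)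
  have h5 : ∫ y in (closedBall x δ)ᶜ, F y ∂q ≤ Φ (δ / r) * q.real univ := by
    have : ∫ y in (closedBall x δ)ᶜ, F y ∂q ≤ ∫ y in (closedBall x δ)ᶜ, Φ (δ / r) ∂q := by
      refine setIntegral_mono_on (hFi q inferInstance).integrableOn (integrable_const _)
        measurableSet_closedBall.compl fun y hy => hΦ ?_
      have : δ < dist y x := by simpa using hy
      gcongr
    refine this.trans ?_
    rw [setIntegral_const, smul_eq_mul, mul_comm]
    gcongr
    · exact hΦ0 _
    · simp
    · exact subset_univ _
  have h6 : ∫ y, F y ∂q = ∫ y in closedBall x δ, F y ∂q + ∫ y in (closedBall x δ)ᶜ, F y ∂q :=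
    (integral_add_compl measurableSet_closedBall (hFi q inferInstance)).symm
  have h7 : Φ ρ * p.real (closedBall x (ρ * r)) ≤ ∫ y, F y ∂p := by
    calc Φ ρ * p.real (closedBall x (ρ * r)) = ∫ y in closedBall x (ρ * r), Φ ρ ∂p := by
          rw [setIntegral_const, smul_eq_mul, mul_comm]
      _ ≤ ∫ y in closedBall x (ρ * r), F y ∂p := by
          refine setIntegral_mono_on (integrable_const _) (hFi p inferInstance).integrableOn
            measurableSet_closedBall fun y hy => hΦ ?_
          rw [div_le_iff₀ hr]
          exact hy
      _ ≤ _ := setIntegral_le_integral (hFi p inferInstance) (ae_of_all _ hF0)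
  have hP : 0 ≤ ∫ y, F y ∂p := integral_nonneg hF0
  have h8 : ∫ y, F y ∂q ≤ ε * ∫ y, F y ∂p + Φ (δ / r) * q.real univ := by
    rw [h6]
    have : (ε : ℝ) * ∫ y in closedBall x δ, F y ∂p ≤ ε * ∫ y, F y ∂p := by gcongr
    linarith
  have h9 := le_abs_self (∫ y, G y ∂p - ∫ y, G y ∂q)
  have h10 : C * ∫ y, G y ∂p ≤ C * (|∫ y, G y ∂p - ∫ y, G y ∂q| +
      C * (ε * ∫ y, F y ∂p + Φ (δ / r) * q.real univ)) := by
    gcongr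
    have : C * ∫ y, F y ∂q ≤ C * (ε * ∫ y, F y ∂p + Φ (δ / r) * q.real univ) := by gcongr
    linarith
  have h11 : C ^ 2 * ε * ∫ y, F y ∂p ≤ 1 / 2 * ∫ y, F y ∂p := by gcongr
  nlinarith

/-! ### Efficient coverings by enlargements of disjoint balls -/

/-- Every set of finite `f`-Hausdorff measure is covered by the `5/2`-enlargements of a disjoint
family of small balls centred in it whose `f`-cost is at most `C` times the measure, up to a
small error. -/
def HasDisjointCovers (d : ℕ) (f : ℝ≥0 → ℝ≥0) (C : ℝ≥0) : Prop :=
  ∀ A : Set (EuclideanSpace ℝ (Fin d)), weightedHausdorff d f A ≠ ⊤ →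
    ∀ s : ℝ, 0 < s → ∀ η : ℝ≥0, 0 < η →
      ∃ (u : Set ℕ) (x : ℕ → EuclideanSpace ℝ (Fin d)) (r : ℕ → ℝ≥0),
        (∀ n ∈ u, 0 < r n ∧ (r n : ℝ) ≤ s ∧ x n ∈ A) ∧
        u.PairwiseDisjoint (fun n => ball (x n) (r n : ℝ)) ∧
        A ⊆ ⋃ n ∈ u, closedBall (x n) (5 / 2 * r n) ∧
        ∑' n : u, (f (r n) : ℝ≥0∞) ≤ C * (weightedHausdorff d f A + η)

/-- A nearly optimal cover is replaced by balls centred in `A` with radii comparable to the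
diameters, and Vitali's lemma selects disjoint ones. Doubling of `f` pays for the factor 4 in the
radii. -/
theorem IsRegularWeight.exists_hasDisjointCovers {f : ℝ≥0 → ℝ≥0} (hf : IsRegularWeight f)
    (d : ℕ) : ∃ C : ℝ≥0, HasDisjointCovers d f C := by
  obtain ⟨C, hC⟩ := hf.exists_map_mul_le 4
  refine ⟨C, fun A hA s hs η hη => ?_⟩
  have hη' : (η : ℝ≥0∞) / 2 ≠ 0 := by simp [hη.ne']
  obtain ⟨t, htA, htd, hts⟩ : ∃ t : ℕ → Set (EuclideanSpace ℝ (Fin d)), A ⊆ iUnion t ∧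
      (∀ n, ediam (t n) ≤ ENNReal.ofReal (s / 8)) ∧
      ∑' n, ⨆ _ : (t n).Nonempty, extendTop f (ediam (t n)) <
        weightedHausdorff d f A + η / 2 := by
    have h1 : (⨅ (t : ℕ → Set (EuclideanSpace ℝ (Fin d))) (_ : A ⊆ iUnion t)
        (_ : ∀ n, ediam (t n) ≤ ENNReal.ofReal (s / 8)),
          ∑' n, ⨆ _ : (t n).Nonempty, extendTop f (ediam (t n))) ≤ weightedHausdorff d f A := by
      conv_rhs => rw [weightedHausdorff, Measure.mkMetric_apply]
      exact le_iSup₂_of_le (ENNReal.ofReal (s / 8)) (by simpa using hs) le_rfl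
    have h2 := h1.trans_lt (ENNReal.lt_add_right hA hη')
    simpa only [iInf_lt_iff, exists_prop] using h2
  obtain ⟨e, he, hes⟩ := ENNReal.exists_pos_sum_of_countable hη' ℕ
  set D : ℕ → ℝ≥0 := fun n => (ediam (t n)).toNNReal
  have hDtop : ∀ n, ediam (t n) ≠ ⊤ := fun n => ne_top_of_le_ne_top ENNReal.ofReal_ne_top (htd n)
  have hD : ∀ n, (D n : ℝ≥0∞) = ediam (t n) := fun n => ENNReal.coe_toNNReal (hDtop n)
  have hDs : ∀ n, (D n : ℝ) ≤ s / 8 := fun n => by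
    have := htd n
    rw [← hD, ← ENNReal.ofReal_coe_nnreal] at this
    exact (ENNReal.ofReal_le_ofReal_iff (by positivity)).1 this
  -- Diameters may be 0 but radii must be positive; continuity of `f` makes the increase cost at
  -- most the summable `e n`.
  have ha : ∀ n, ∃ a : ℝ≥0, D n < a ∧ (a : ℝ) ≤ s / 4 ∧ f a ≤ f (D n) + e n := by
    intro n
    have h1 : ∀ᶠ a in 𝓝[>] (D n), f a < f (D n) + e n :=
      ((hf.continuous.tendsto (D n)).mono_left nhdsWithin_le_nhds).eventually
        (gt_mem_nhds (lt_add_of_pos_right _ (he n)))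
    have h2 : ∀ᶠ a : ℝ≥0 in 𝓝[>] (D n), (a : ℝ) < s / 4 :=
      ((NNReal.continuous_coe.tendsto (D n)).mono_left nhdsWithin_le_nhds).eventually
        (gt_mem_nhds (by linarith [hDs n]))
    obtain ⟨a, h1, h2, h3⟩ := (h1.and (h2.and self_mem_nhdsWithin)).exists
    exact ⟨a, h3, h2.le, h1.le⟩
  choose a haD has haf using ha
  have hx : ∀ n, ∃ x, (t n ∩ A).Nonempty → x ∈ t n ∩ A := fun n => by
    by_cases h : (t n ∩ A).Nonempty
    · exact ⟨h.some, fun _ => h.some_mem⟩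
    · exact ⟨0, fun h' => absurd h' h⟩
  choose x hx using hx
  have ha0 : ∀ n, 0 < a n := fun n => bot_le.trans_lt (haD n)
  -- The ratio `6/5` yields `5/2`: if the ball of index `n` meets the selected one of index `m` and
  -- `a n ≤ 6/5 * a m`, then points of `t n` lie within `a n + 4 a n + 4 a m ≤ 10 a m = 5/2 * (4 a
  -- m)` of `x m`.
  obtain ⟨u, huT, hud, hu⟩ := Vitali.exists_disjoint_subfamily_covering_enlargement
    (fun n => ball (x n) ((4 * a n : ℝ≥0) : ℝ)) {n | (t n ∩ A).Nonempty}
    (fun n => ((4 * a n : ℝ≥0) : ℝ)) (6 / 5) (by norm_num) (fun n _ => NNReal.coe_nonneg _) s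
    (fun n _ => by push_cast; linarith [has n])
    (fun n _ => nonempty_ball.2 (by have := ha0 n; positivity))
  refine ⟨u, x, fun n => 4 * a n, fun n hn => ⟨?_, ?_, (hx n (huT hn)).2⟩, hud, ?_, ?_⟩
  · have := ha0 n; positivity
  · push_cast; linarith [has n]
  · intro y hy
    obtain ⟨n, hn⟩ := mem_iUnion.1 (htA hy)
    have hne : (t n ∩ A).Nonempty := ⟨y, hn, hy⟩
    obtain ⟨m, hm, ⟨z, hzn, hzm⟩, hnm⟩ := hu n hne
    refine mem_iUnion₂.2 ⟨m, hm, ?_⟩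
    have h1 : dist y (x n) ≤ D n := by
      have := edist_le_ediam_of_mem hn (hx n hne).1
      rw [← hD, edist_nndist, ENNReal.coe_le_coe] at this
      exact this
    have h2 : (D n : ℝ) < a n := haD n
    have h3 := dist_triangle4 y (x n) z (x m)
    rw [mem_ball] at hzn hzm
    rw [dist_comm] at hzn
    rw [mem_closedBall]
    push_cast at hzn hzm hnm ⊢
    linarith
  · calc ∑' n : u, (f (4 * a n) : ℝ≥0∞)
        ≤ ∑' n : u, (C : ℝ≥0∞) * ((⨆ _ : (t n).Nonempty, extendTop f (ediam (t n))) + e n) := by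
          refine ENNReal.tsum_le_tsum fun n => ?_
          have hne : (t n).Nonempty := (huT n.2).mono inter_subset_left
          rw [iSup_pos hne, ← hD, extendTop_coe]
          exact_mod_cast (hC (a n)).trans (by gcongr; exact haf n)
      _ ≤ C * ∑' n, ((⨆ _ : (t n).Nonempty, extendTop f (ediam (t n))) + e n) := by
          rw [ENNReal.tsum_mul_left]
          gcongr
          exact ENNReal.tsum_comp_le_tsum_of_injective Subtype.val_injective
            (fun n => (⨆ _ : (t n).Nonempty, extendTop f (ediam (t n))) + (e n : ℝ≥0∞))
      _ ≤ C * (weightedHausdorff d f A + η) := by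
          rw [ENNReal.tsum_add]
          refine mul_le_mul_right ?_ _
          calc _ ≤ weightedHausdorff d f A + η / 2 + η / 2 := add_le_add hts.le hes.le
            _ = _ := by rw [add_assoc, ENNReal.add_halves]

/-! ### The two bounds for a measure -/

/-- `Φ t ≤ κ f (1 / t)` for all large `t`. -/
def EventuallyLeWeight (f : ℝ≥0 → ℝ≥0) (Φ : ℝ → ℝ) (κ : ℝ≥0) : Prop :=
  ∃ R : ℝ, ∀ t : ℝ≥0, R ≤ t → Φ t ≤ κ * f t⁻¹

theorem measure_le_of_forall_closedBall_le {d : ℕ} {f g : ℝ≥0 → ℝ≥0}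
    (hg : IsRegularWeight g) {C₁ : ℝ≥0} (hC₁ : HasDisjointCovers d f C₁)
    {p q : Measure (EuclideanSpace ℝ (Fin d))} [IsFiniteMeasure p] [IsFiniteMeasure q]
    {Φ : ℝ → ℝ} (hΦ : Antitone Φ) (hΦ0 : ∀ t, 0 ≤ Φ t) (hΦpos : 0 < Φ (5 / 2))
    {ψ : EuclideanSpace ℝ (Fin d) → ℝ} (hψ : Measurable ψ) {C : ℝ} (hC : 0 < C)
    (hΦψ : ∀ x, Φ ‖x‖ ≤ C * ψ x ∧ ψ x ≤ C * Φ ‖x‖) {ε : ℝ≥0} (hε : C ^ 2 * ε ≤ 1 / 2)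
    {K : ℝ≥0} (hpq : PairFrostman f g ψ K p q) {δ : ℝ≥0} (hδ : 0 < δ)
    {A : Set (EuclideanSpace ℝ (Fin d))}
    (h : ∀ x ∈ A, ∀ s, 0 ≤ s → s ≤ (δ : ℝ) → q (closedBall x s) ≤ ε * p (closedBall x s))
    {Cδ : ℝ≥0} (hCδ : ∀ t, f (δ⁻¹ * t) ≤ Cδ * f t)
    {κ : ℝ≥0} (hκ : EventuallyLeWeight f Φ κ) {L : ℝ≥0} (hL : weightedHausdorff d f A = L) :
    p A ≤ (((2 * C / Φ (5 / 2)).toNNReal * (K * g (C₁ * L)) +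
      (2 * C ^ 2 * q.real univ / Φ (5 / 2)).toNNReal * (κ * Cδ * (C₁ * L)) : ℝ≥0) : ℝ≥0∞) := by
  set a : ℝ≥0 := (2 * C / Φ (5 / 2)).toNNReal
  set b : ℝ≥0 := (2 * C ^ 2 * q.real univ / Φ (5 / 2)).toNNReal
  have hball : ∀ (x : EuclideanSpace ℝ (Fin d)) (r : ℝ≥0), x ∈ A → 0 < r →
      p (closedBall x (5 / 2 * r)) ≤
        a * ENNReal.ofReal |∫ y, ψ ((r : ℝ)⁻¹ • (y - x)) ∂p - ∫ y, ψ ((r : ℝ)⁻¹ • (y - x)) ∂q| +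
          b * ENNReal.ofReal (Φ (δ / r)) := by
    intro x r hx hr
    have h1 := measureReal_closedBall_le (p := p) (q := q) hΦ hΦ0 hψ hC hΦψ hε (h x hx)
      (NNReal.coe_pos.2 hr) (5 / 2)
    rw [← ofReal_measureReal]
    set I := |∫ y, ψ ((r : ℝ)⁻¹ • (y - x)) ∂p - ∫ y, ψ ((r : ℝ)⁻¹ • (y - x)) ∂q|
    have hI : 0 ≤ I := abs_nonneg _
    have ha : (0 : ℝ) ≤ 2 * C / Φ (5 / 2) := by positivity
    have hb : (0 : ℝ) ≤ 2 * C ^ 2 * q.real univ / Φ (5 / 2) := by positivity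
    change _ ≤ ENNReal.ofReal _ * _ + ENNReal.ofReal _ * _
    rw [← ENNReal.ofReal_mul ha, ← ENNReal.ofReal_mul hb,
      ← ENNReal.ofReal_add (by positivity) (mul_nonneg hb (hΦ0 _))]
    apply ENNReal.ofReal_le_ofReal
    rw [div_mul_eq_mul_div (2 * C), div_mul_eq_mul_div (2 * C ^ 2 * _), ← add_div, le_div_iff₀ hΦpos, mul_comm]
    exact h1
  obtain ⟨R, hR⟩ := hκ
  have key : ∀ η : ℝ≥0, 0 < η →
      p A ≤ ((a * (K * g (C₁ * (L + η))) + b * (κ * Cδ * (C₁ * (L + η))) : ℝ≥0) : ℝ≥0∞) := by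
    intro η hη
    -- Radii at most `δ / max R 1` put `δ / r` in the range where the decay of `Φ` applies; the
    -- maximum with 1 keeps the denominator positive.
    have hR0 : (0 : ℝ) < max R 1 := lt_max_of_lt_right one_pos
    obtain ⟨u, x, r, hr, hd, hcov, hsum⟩ := hC₁ A (by rw [hL]; exact ENNReal.coe_ne_top)
      (δ / max R 1) (by positivity) η hη
    rw [hL] at hsum
    have hfar : ∀ n ∈ u, ENNReal.ofReal (Φ (δ / r n)) ≤ ((κ * Cδ : ℝ≥0) : ℝ≥0∞) * f (r n) := by
      intro n hn
      obtain ⟨hr0, hrs, -⟩ := hr n hn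
      have h1 : R ≤ ((δ / r n : ℝ≥0) : ℝ) := by
        rw [NNReal.coe_div, le_div_iff₀ (NNReal.coe_pos.2 hr0)]
        rw [le_div_iff₀ hR0] at hrs
        calc R * r n ≤ max R 1 * r n := by gcongr; exact le_max_left _ _
          _ ≤ δ := by linarith
      have h2 := hR _ h1
      have h3 : f (δ / r n)⁻¹ ≤ Cδ * f (r n) := by
        rw [inv_div, div_eq_inv_mul]
        exact hCδ _
      have h4 : Φ (δ / r n) ≤ ((κ * Cδ * f (r n) : ℝ≥0) : ℝ) := by
        rw [NNReal.coe_div] at h2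
        refine h2.trans ?_
        have h3' : (f (δ / r n)⁻¹ : ℝ) ≤ Cδ * f (r n) := by exact_mod_cast h3
        push_cast
        rw [mul_assoc]
        gcongr
      calc _ ≤ ENNReal.ofReal ((κ * Cδ * f (r n) : ℝ≥0) : ℝ) := ENNReal.ofReal_le_ofReal h4
        _ = _ := by rw [ENNReal.ofReal_coe_nnreal]; push_cast; rfl
    calc p A ≤ p (⋃ n ∈ u, closedBall (x n) (5 / 2 * r n)) := measure_mono hcov
      _ ≤ ∑' n : u, p (closedBall (x n) (5 / 2 * r n)) := measure_biUnion_le p u.to_countable _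
      _ ≤ ∑' n : u, (a * ENNReal.ofReal |∫ y, ψ ((r n : ℝ)⁻¹ • (y - x n)) ∂p -
            ∫ y, ψ ((r n : ℝ)⁻¹ • (y - x n)) ∂q| +
            b * (((κ * Cδ : ℝ≥0) : ℝ≥0∞) * f (r n))) := by
          refine ENNReal.tsum_le_tsum fun n => ?_
          obtain ⟨hr0, -, hxA⟩ := hr n n.2
          refine (hball _ _ hxA hr0).trans ?_
          gcongr
          exact hfar n n.2
      _ ≤ a * (K * extendTop g (C₁ * (L + η))) +
            b * (((κ * Cδ : ℝ≥0) : ℝ≥0∞) * (C₁ * (L + η))) := by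
          rw [ENNReal.tsum_add, ENNReal.tsum_mul_left, ENNReal.tsum_mul_left,
            ENNReal.tsum_mul_left]
          gcongr
          refine (hpq u x r (fun n hn => (hr n hn).1) hd).trans ?_
          gcongr
          exact extendTop_mono hg.monotone hsum
      _ = _ := by
          rw [← ENNReal.coe_add, ← ENNReal.coe_mul, extendTop_coe]
          push_cast
          rfl
  have hcont : Continuous fun η : ℝ≥0 =>
      ((a * (K * g (C₁ * (L + η))) + b * (κ * Cδ * (C₁ * (L + η))) : ℝ≥0) : ℝ≥0∞) := by
    have := hg.continuous
    fun_prop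
  have hlim := (hcont.tendsto 0).mono_left (nhdsWithin_le_nhds (s := Ioi 0))
  simp only [add_zero] at hlim
  exact ge_of_tendsto hlim (by filter_upwards [self_mem_nhdsWithin] with η hη using key η hη)

/-- To bound `p A` it suffices to bound the measure of those parts of `A` about whose points `q` is
uniformly small compared to `p`. -/
theorem measure_le_of_forall_uniform {d : ℕ} {p q : Measure (EuclideanSpace ℝ (Fin d))}
    [IsFiniteMeasure p] [IsFiniteMeasure q] (hqp : q ⟂ₘ p) {ε : ℝ≥0} (hε : 0 < ε)
    {A : Set (EuclideanSpace ℝ (Fin d))} {b : ℝ≥0∞}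
    (h : ∀ B ⊆ A, ∀ δ : ℝ≥0, 0 < δ → (∀ x ∈ B, ∀ s, 0 ≤ s → s ≤ (δ : ℝ) →
      q (closedBall x s) ≤ ε * p (closedBall x s)) → p B ≤ b) : p A ≤ b := by
  set B : ℕ → Set (EuclideanSpace ℝ (Fin d)) := fun n => {x ∈ A | ∀ s : ℝ, 0 ≤ s →
    s ≤ (((n : ℝ≥0) + 1)⁻¹ : ℝ≥0) → q (closedBall x s) ≤ ε * p (closedBall x s)}
  have hB : Monotone B := fun m n hmn x hx => ⟨hx.1, fun s hs hsn => hx.2 s hs (hsn.trans (by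
    push_cast; gcongr))⟩
  have hae : A ≤ᵐ[p] ⋃ n, B n := by
    filter_upwards [ae_exists_closedBall_le hqp hε] with x hx hxA
    obtain ⟨δ, hδ, hδs⟩ := hx
    obtain ⟨n, hn⟩ := exists_nat_one_div_lt hδ
    refine mem_iUnion.2 ⟨n, hxA, fun s hs hsn => hδs s hs (hsn.trans ?_)⟩
    push_cast
    rw [← one_div]
    exact hn.le
  calc p A ≤ p (⋃ n, B n) := measure_mono_ae hae
    -- Continuity along increasing unions needs no measurability of the `B n`.
    _ = ⨆ n, p (B n) := hB.measure_iUnion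
    _ ≤ b := iSup_le fun n => h (B n) (fun x hx => hx.1) _ (by positivity) fun x hx => hx.2

/-- For fixed `δ`, both `Cδ` and `q univ` enter only multiplied by `κ`, so `κ → 0` leaves a bound
independent of them. -/
theorem measure_le_of_isLittleO {d : ℕ} {f g : ℝ≥0 → ℝ≥0} (hf : IsRegularWeight f)
    (hg : IsRegularWeight g) {C₁ : ℝ≥0} (hC₁ : HasDisjointCovers d f C₁)
    {p q : Measure (EuclideanSpace ℝ (Fin d))} [IsFiniteMeasure p] [IsFiniteMeasure q]
    (hqp : q ⟂ₘ p)
    {Φ : ℝ → ℝ} (hΦ : Antitone Φ) (hΦ0 : ∀ t, 0 ≤ Φ t) (hΦpos : 0 < Φ (5 / 2))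
    {ψ : EuclideanSpace ℝ (Fin d) → ℝ} (hψ : Measurable ψ) {C : ℝ} (hC : 0 < C)
    (hΦψ : ∀ x, Φ ‖x‖ ≤ C * ψ x ∧ ψ x ≤ C * Φ ‖x‖)
    {K : ℝ≥0} (hpq : PairFrostman f g ψ K p q)
    (hκ : ∀ κ : ℝ≥0, 0 < κ → EventuallyLeWeight f Φ κ)
    {A : Set (EuclideanSpace ℝ (Fin d))} {L : ℝ≥0} (hL : weightedHausdorff d f A = L) :
    p A ≤ (((2 * C / Φ (5 / 2)).toNNReal * (K * g (C₁ * L)) : ℝ≥0) : ℝ≥0∞) := by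
  have hε : 0 < (1 / (2 * C ^ 2)).toNNReal := Real.toNNReal_pos.2 (by positivity)
  refine measure_le_of_forall_uniform hqp hε fun B hBA δ hδ hB => ?_
  obtain ⟨Cδ, hCδ⟩ := hf.exists_map_mul_le δ⁻¹
  have hBL : weightedHausdorff d f B ≤ L := hL ▸ measure_mono hBA
  obtain ⟨L', hL'⟩ : ∃ L' : ℝ≥0, weightedHausdorff d f B = L' :=
    ⟨_, (ENNReal.coe_toNNReal (ne_top_of_le_ne_top ENNReal.coe_ne_top hBL)).symm⟩
  have key := fun (κ : ℝ≥0) (h : 0 < κ) =>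
    measure_le_of_forall_closedBall_le hg hC₁ hΦ hΦ0 hΦpos hψ hC hΦψ
    (by rw [Real.coe_toNNReal _ (by positivity)]; field_simp; rfl) hpq hδ hB hCδ (hκ κ h) hL'
  set b : ℝ≥0 := (2 * C ^ 2 * q.real univ / Φ (5 / 2)).toNNReal
  set a : ℝ≥0 := (2 * C / Φ (5 / 2)).toNNReal
  have hcont : Continuous fun κ : ℝ≥0 =>
      ((a * (K * g (C₁ * L')) + b * (κ * Cδ * (C₁ * L')) : ℝ≥0) : ℝ≥0∞) := by fun_prop
  have hlim := (hcont.tendsto 0).mono_left (nhdsWithin_le_nhds (s := Ioi 0))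
  simp only [zero_mul, mul_zero, add_zero] at hlim
  refine (ge_of_tendsto hlim
    (by filter_upwards [self_mem_nhdsWithin] with κ h using key κ h)).trans ?_
  have hLL : L' ≤ L := by rw [hL'] at hBL; exact_mod_cast hBL
  exact_mod_cast mul_le_mul_right (mul_le_mul_right (hg.monotone (by gcongr)) K) a

theorem measure_eq_zero_of_isBigO {d : ℕ} {f g : ℝ≥0 → ℝ≥0} (hf : IsRegularWeight f)
    (hg : IsRegularWeight g)
    {p q : Measure (EuclideanSpace ℝ (Fin d))} [IsFiniteMeasure p] [IsFiniteMeasure q]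
    (hqp : q ⟂ₘ p)
    {Φ : ℝ → ℝ} (hΦ : Antitone Φ) (hΦ0 : ∀ t, 0 ≤ Φ t) (hΦpos : 0 < Φ (5 / 2))
    {ψ : EuclideanSpace ℝ (Fin d) → ℝ} (hψ : Measurable ψ) {C : ℝ} (hC : 0 < C)
    (hΦψ : ∀ x, Φ ‖x‖ ≤ C * ψ x ∧ ψ x ≤ C * Φ ‖x‖)
    {K : ℝ≥0} (hpq : PairFrostman f g ψ K p q) {κ : ℝ≥0} (hκ : EventuallyLeWeight f Φ κ)
    {A : Set (EuclideanSpace ℝ (Fin d))} (hA : weightedHausdorff d f A = 0) : p A = 0 := by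
  obtain ⟨C₁, hC₁⟩ := hf.exists_hasDisjointCovers d
  have hε : 0 < (1 / (2 * C ^ 2)).toNNReal := Real.toNNReal_pos.2 (by positivity)
  refine le_antisymm ?_ bot_le
  refine measure_le_of_forall_uniform hqp hε fun B hBA δ hδ hB => ?_
  obtain ⟨Cδ, hCδ⟩ := hf.exists_map_mul_le δ⁻¹
  have key := measure_le_of_forall_closedBall_le hg hC₁ hΦ hΦ0 hΦpos hψ hC hΦψ
    (by rw [Real.coe_toNNReal _ (by positivity)]; field_simp; rfl) hpq hδ hB hCδ hκ
    (L := 0) (by simpa using measure_mono_null hBA hA)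
  simpa [hg.map_zero] using key

/-! ### Radial profiles -/

theorem IsRadiallyNonincreasing.exists_profile {d : ℕ} (hd : d ≠ 0)
    {φ : EuclideanSpace ℝ (Fin d) → ℝ} (hφ : IsRadiallyNonincreasing φ) :
    ∃ Φ : ℝ → ℝ, Antitone Φ ∧ ∀ x, φ x = Φ ‖x‖ := by
  have : NeZero d := ⟨hd⟩
  obtain ⟨e, he⟩ : ∃ e : EuclideanSpace ℝ (Fin d), ‖e‖ = 1 := exists_norm_eq _ zero_le_one
  have hn : ∀ t : ℝ, ‖max t 0 • e‖ = max t 0 := fun t => by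
    rw [norm_smul, he, mul_one, Real.norm_of_nonneg (le_max_right _ _)]
  -- Truncation at 0 makes the profile antitone on the whole line.
  refine ⟨fun t => φ (max t 0 • e), fun s t hst => hφ.nonincreasing _ _ ?_, fun x => ?_⟩
  · rw [hn, hn]
    exact max_le_max_right 0 hst
  · refine hφ.radial _ _ ?_
    rw [hn, max_eq_left (norm_nonneg x)]

theorem exists_forall_abs_profile_le {d : ℕ} (hd : d ≠ 0) {f : ℝ≥0 → ℝ≥0}
    {φ : EuclideanSpace ℝ (Fin d) → ℝ} {Φ : ℝ → ℝ} (hφΦ : ∀ x, φ x = Φ ‖x‖) {κ : ℝ≥0}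
    (h : IsBigOWith κ (Bornology.cobounded (EuclideanSpace ℝ (Fin d))) φ
      fun x => (f ‖x‖₊⁻¹ : ℝ)) :
    ∃ R : ℝ, ∀ t : ℝ≥0, R ≤ t → |Φ t| ≤ κ * f t⁻¹ := by
  have : NeZero d := ⟨hd⟩
  have h1 := h.bound
  rw [← comap_norm_atTop, eventually_comap, eventually_atTop] at h1
  obtain ⟨R, hR⟩ := h1
  refine ⟨R, fun t ht => ?_⟩
  obtain ⟨x, hx⟩ : ∃ x : EuclideanSpace ℝ (Fin d), ‖x‖ = t := exists_norm_eq _ t.2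
  have h2 := hR t ht x hx
  have h3 : ‖x‖₊ = t := NNReal.eq hx
  simpa [hφΦ, hx, h3] using h2

/-- A non-increasing function with limit 0 at infinity is nonnegative; the limit is 0 because `f` is
continuous at 0 with `f 0 = 0`. -/
theorem profile_nonneg {f : ℝ≥0 → ℝ≥0} (hf : IsRegularWeight f) {Φ : ℝ → ℝ} (hΦ : Antitone Φ)
    {κ : ℝ≥0} (h : ∃ R : ℝ, ∀ t : ℝ≥0, R ≤ t → |Φ t| ≤ κ * f t⁻¹) (s : ℝ) : 0 ≤ Φ s := by
  obtain ⟨R, hR⟩ := h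
  have h1 : Tendsto (fun t : ℝ≥0 => -((κ * f t⁻¹ : ℝ≥0) : ℝ)) atTop (𝓝 0) := by
    have hc : Continuous fun t : ℝ≥0 => -((κ * f t : ℝ≥0) : ℝ) := by
      have := hf.continuous
      fun_prop
    have := (hc.tendsto 0).comp (tendsto_inv_atTop_zero (𝕜 := ℝ≥0))
    simpa [hf.map_zero, Function.comp_def] using this
  refine le_of_tendsto h1 ?_
  filter_upwards [eventually_ge_atTop (max R s).toNNReal] with t ht
  have ht' : max R s ≤ t := Real.toNNReal_le_iff_le_coe.1 ht
  have h2 := neg_le_of_abs_le (hR t ((le_max_left _ _).trans ht'))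
  push_cast
  exact h2.trans (hΦ ((le_max_right _ _).trans ht'))

theorem profile_pos {d : ℕ} (hd : d ≠ 0) {φ : EuclideanSpace ℝ (Fin d) → ℝ} {Φ : ℝ → ℝ}
    (hΦ : Antitone Φ) (hΦ0 : ∀ t, 0 ≤ Φ t) (hφΦ : ∀ x, φ x = Φ ‖x‖)
    (hsupp : ball 0 3 ⊆ tsupport φ) : 0 < Φ (5 / 2) := by
  have : NeZero d := ⟨hd⟩
  -- The support is a closure, so `φ` may vanish at `x` itself; `11/4` leaves room for a nearby
  -- nonzero point of norm at least `5/2`.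
  obtain ⟨x, hx⟩ : ∃ x : EuclideanSpace ℝ (Fin d), ‖x‖ = 11 / 4 := exists_norm_eq _ (by norm_num)
  have hxs : x ∈ tsupport φ := hsupp (by rw [mem_ball_zero_iff, hx]; norm_num)
  obtain ⟨y, hy, hxy⟩ := Metric.mem_closure_iff.1 hxs (1 / 4) (by norm_num)
  have h1 : 5 / 2 ≤ ‖y‖ := by
    have := norm_sub_norm_le x y
    rw [dist_eq_norm] at hxy
    linarith
  have h2 : Φ ‖y‖ ≠ 0 := by rw [← hφΦ]; exact hy
  exact ((hΦ0 _).lt_of_ne h2.symm).trans_le (hΦ h1)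

theorem apply_zero_ne_zero_of_subsingleton {φ ψ : EuclideanSpace ℝ (Fin 0) → ℝ}
    (hsupp : ball 0 3 ⊆ tsupport φ) (hφψ : EquivalentFun φ ψ) : ψ 0 ≠ 0 := by
  intro h
  obtain ⟨C, hC, hCφ⟩ := hφψ
  obtain ⟨h1, h2⟩ := hCφ 0
  rw [h, mul_zero] at h1
  rw [h] at h2
  have h3 : φ 0 = 0 := le_antisymm h1 (nonneg_of_mul_nonneg_right h2 hC)
  have h4 : (0 : EuclideanSpace ℝ (Fin 0)) ∈ tsupport φ := hsupp (by simp)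
  obtain ⟨y, hy⟩ := closure_nonempty_iff.1 ⟨_, h4⟩
  exact hy (by rw [Subsingleton.elim y 0, h3])

/-! ### Signed measures -/

theorem totalVariation_le_of_isLittleO {d : ℕ} {f g : ℝ≥0 → ℝ≥0} (hf : IsRegularWeight f)
    (hg : IsRegularWeight g) {φ ψ : EuclideanSpace ℝ (Fin d) → ℝ}
    (hφ_bdd : ∃ M : ℝ, ∀ x, |φ x| ≤ M) (hφ_rad : IsRadiallyNonincreasing φ)
    (hφ_supp : ball 0 3 ⊆ tsupport φ) (hψ_meas : Measurable ψ) (hφψ : EquivalentFun φ ψ)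
    (h : φ =o[Bornology.cobounded (EuclideanSpace ℝ (Fin d))] fun x => (f ‖x‖₊⁻¹ : ℝ))
    (K : ℝ≥0) : ∃ C : ℝ≥0, ∀ μ : SignedMeasure (EuclideanSpace ℝ (Fin d)),
      FrostmanCondition f g ψ K μ → ∀ A : Set (EuclideanSpace ℝ (Fin d)),
        weightedHausdorff d f A < ⊤ →
          μ.totalVariation A ≤ C * extendTop g (weightedHausdorff d f A) := by
  rcases eq_or_ne d 0 with rfl | hd
  · refine ⟨0, fun μ hμ A _ => ?_⟩
    rw [hμ.eq_zero_of_subsingleton hf hg (apply_zero_ne_zero_of_subsingleton hφ_supp hφψ),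
      SignedMeasure.totalVariation_zero]
    simp
  obtain ⟨Φ, hΦ, hφΦ⟩ := hφ_rad.exists_profile hd
  have hκ : ∀ κ : ℝ≥0, 0 < κ → ∃ R : ℝ, ∀ t : ℝ≥0, R ≤ t → |Φ t| ≤ κ * f t⁻¹ := fun κ hκ =>
    exists_forall_abs_profile_le hd hφΦ (h.forall_isBigOWith (NNReal.coe_pos.2 hκ))
  have hκ' : ∀ κ : ℝ≥0, 0 < κ → EventuallyLeWeight f Φ κ := fun κ h0 =>
    let ⟨R, hR⟩ := hκ κ h0
    ⟨R, fun t ht => (le_abs_self _).trans (hR t ht)⟩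
  have hΦ0 := profile_nonneg hf hΦ (hκ 1 one_pos)
  have hΦpos := profile_pos hd hΦ hΦ0 hφΦ hφ_supp
  obtain ⟨C, hC, hCφ⟩ := hφψ
  obtain ⟨M, hM⟩ := hφ_bdd
  simp only [hφΦ] at hCφ hM
  have hψM : ∀ x, |ψ x| ≤ C * M := fun x => by
    have h1 : 0 ≤ ψ x := nonneg_of_mul_nonneg_right ((hΦ0 _).trans (hCφ x).1) hC
    rw [abs_of_nonneg h1]
    exact (hCφ x).2.trans (by gcongr; exact (le_abs_self _).trans (hM x))
  obtain ⟨C₁, hC₁⟩ := hf.exists_hasDisjointCovers d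
  obtain ⟨C₂, hC₂⟩ := hg.exists_map_mul_le C₁
  -- The 2 counts the two Jordan parts, and `C₂` absorbs the covering constant `C₁` inside `g`.
  refine ⟨2 * ((2 * C / Φ (5 / 2)).toNNReal * K * C₂), fun μ hμ A hA => ?_⟩
  obtain ⟨L, hL⟩ : ∃ L : ℝ≥0, weightedHausdorff d f A = L :=
    ⟨_, (ENNReal.coe_toNNReal hA.ne).symm⟩
  have hpq := hμ.pairFrostman hψ_meas hψM
  have hsing := μ.toJordanDecomposition.mutuallySingular
  have h1 := measure_le_of_isLittleO hf hg hC₁ hsing.symm hΦ hΦ0 hΦpos hψ_meas hC hCφ hpq hκ' hL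
  have h2 := measure_le_of_isLittleO hf hg hC₁ hsing hΦ hΦ0 hΦpos hψ_meas hC hCφ hpq.symm hκ' hL
  rw [hL, extendTop_coe, SignedMeasure.totalVariation, Measure.add_apply]
  refine (add_le_add h1 h2).trans ?_
  set a : ℝ≥0 := (2 * C / Φ (5 / 2)).toNNReal
  rw [← ENNReal.coe_add, ← ENNReal.coe_mul, ENNReal.coe_le_coe, ← two_mul]
  calc 2 * (a * (K * g (C₁ * L))) ≤ 2 * (a * (K * (C₂ * g L))) := by gcongr; exact hC₂ L
    _ = _ := by ring

theorem totalVariation_absolutelyContinuous_of_isBigO {d : ℕ} {f g : ℝ≥0 → ℝ≥0}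
    (hf : IsRegularWeight f) (hg : IsRegularWeight g) {φ ψ : EuclideanSpace ℝ (Fin d) → ℝ}
    (hφ_bdd : ∃ M : ℝ, ∀ x, |φ x| ≤ M) (hφ_rad : IsRadiallyNonincreasing φ)
    (hφ_supp : ball 0 3 ⊆ tsupport φ) (hψ_meas : Measurable ψ) (hφψ : EquivalentFun φ ψ)
    (h : φ =O[Bornology.cobounded (EuclideanSpace ℝ (Fin d))] fun x => (f ‖x‖₊⁻¹ : ℝ))
    {K : ℝ≥0} {μ : SignedMeasure (EuclideanSpace ℝ (Fin d))}
    (hμ : FrostmanCondition f g ψ K μ) : μ.totalVariation ≪ weightedHausdorff d f := by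
  rcases eq_or_ne d 0 with rfl | hd
  · rw [hμ.eq_zero_of_subsingleton hf hg (apply_zero_ne_zero_of_subsingleton hφ_supp hφψ),
      SignedMeasure.totalVariation_zero]
    exact Measure.AbsolutelyContinuous.zero _
  obtain ⟨Φ, hΦ, hφΦ⟩ := hφ_rad.exists_profile hd
  obtain ⟨c, hc, hcO⟩ := h.exists_nonneg
  have hκ := exists_forall_abs_profile_le (κ := ⟨c, hc⟩) hd hφΦ hcO
  have hκ' : EventuallyLeWeight f Φ ⟨c, hc⟩ :=
    let ⟨R, hR⟩ := hκ
    ⟨R, fun t ht => (le_abs_self _).trans (hR t ht)⟩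
  have hΦ0 := profile_nonneg hf hΦ hκ
  have hΦpos := profile_pos hd hΦ hΦ0 hφΦ hφ_supp
  obtain ⟨C, hC, hCφ⟩ := hφψ
  obtain ⟨M, hM⟩ := hφ_bdd
  simp only [hφΦ] at hCφ hM
  have hψM : ∀ x, |ψ x| ≤ C * M := fun x => by
    have h1 : 0 ≤ ψ x := nonneg_of_mul_nonneg_right ((hΦ0 _).trans (hCφ x).1) hC
    rw [abs_of_nonneg h1]
    exact (hCφ x).2.trans (by gcongr; exact (le_abs_self _).trans (hM x))
  have hpq := hμ.pairFrostman hψ_meas hψM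
  have hsing := μ.toJordanDecomposition.mutuallySingular
  intro A hA
  rw [SignedMeasure.totalVariation, Measure.add_apply,
    measure_eq_zero_of_isBigO hf hg hsing.symm hΦ hΦ0 hΦpos hψ_meas hC hCφ hpq hκ' hA,
    measure_eq_zero_of_isBigO hf hg hsing hΦ hΦ0 hΦpos hψ_meas hC hCφ hpq.symm hκ' hA, add_zero]

/-- This handles sets of infinite `Λ_f`-measure: the total mass is finite and `g ∞ > 0`, at the
price of a constant depending on `ν`. -/
theorem exists_measure_le_mul_iSup {X : Type*} [MeasurableSpace X] (ν : Measure X)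
    [IsFiniteMeasure ν] {g : ℝ≥0 → ℝ≥0} (hg : g ≠ 0) :
    ∃ C : ℝ≥0, ∀ A, ν A ≤ C * extendTop g ⊤ := by
  obtain ⟨x, hx⟩ := Function.ne_iff.1 hg
  refine ⟨(ν univ).toNNReal / g x, fun A => (measure_mono (subset_univ A)).trans ?_⟩
  calc ν univ = (((ν univ).toNNReal / g x * g x : ℝ≥0) : ℝ≥0∞) := by
        rw [div_mul_cancel₀ _ hx, ENNReal.coe_toNNReal (measure_ne_top _ _)]
    _ ≤ _ := by
        rw [ENNReal.coe_mul, extendTop_top]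
        gcongr
        exact le_iSup (fun x => (g x : ℝ≥0∞)) x

end

theorem mainTheorem10 (d : ℕ) (f g : ℝ≥0 → ℝ≥0) (hf : IsRegularWeight f) (hg : IsRegularWeight g)
    (φ ψ : EuclideanSpace ℝ (Fin d) → ℝ)
    (hφ_bdd : ∃ M : ℝ, ∀ x, |φ x| ≤ M)
    (hφ_rad : IsRadiallyNonincreasing φ)
    (hφ_supp : Metric.ball 0 3 ⊆ tsupport φ)
    (hψ_meas : Measurable ψ)
    (hφψ : EquivalentFun φ ψ) :
    ((φ =O[Bornology.cobounded (EuclideanSpace ℝ (Fin d))] fun x => (f ‖x‖₊⁻¹ : ℝ)) →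
      ∀ μ : SignedMeasure (EuclideanSpace ℝ (Fin d)), (∃ K : ℝ≥0, FrostmanCondition f g ψ K μ) →
        μ.totalVariation ≪ weightedHausdorff d f) ∧
    ((φ =o[Bornology.cobounded (EuclideanSpace ℝ (Fin d))] fun x => (f ‖x‖₊⁻¹ : ℝ)) →
      (∀ K : ℝ≥0, ∃ C : ℝ≥0, ∀ μ : SignedMeasure (EuclideanSpace ℝ (Fin d)),
        FrostmanCondition f g ψ K μ → ∀ A : Set (EuclideanSpace ℝ (Fin d)), MeasurableSet A →
          weightedHausdorff d f A < ⊤ →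
            μ.totalVariation A ≤ C * extendTop g (weightedHausdorff d f A)) ∧
      (g ≠ 0 →
        ∀ μ : SignedMeasure (EuclideanSpace ℝ (Fin d)), (∃ K : ℝ≥0, FrostmanCondition f g ψ K μ) →
          ∃ C : ℝ≥0, ∀ A : Set (EuclideanSpace ℝ (Fin d)), MeasurableSet A →
            μ.totalVariation A ≤ C * extendTop g (weightedHausdorff d f A))) := by
  refine ⟨fun h μ ⟨K, hμ⟩ => totalVariation_absolutelyContinuous_of_isBigO hf hg hφ_bdd hφ_rad
    hφ_supp hψ_meas hφψ h hμ, fun h => ?_⟩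
  have main := totalVariation_le_of_isLittleO hf hg hφ_bdd hφ_rad hφ_supp hψ_meas hφψ h
  refine ⟨fun K => ?_, fun hg0 μ ⟨K, hμ⟩ => ?_⟩
  · obtain ⟨C, hC⟩ := main K
    exact ⟨C, fun μ hμ A _ hA => hC μ hμ A hA⟩
  · obtain ⟨C, hC⟩ := main K
    obtain ⟨C', hC'⟩ := exists_measure_le_mul_iSup μ.totalVariation hg0
    refine ⟨max C C', fun A _ => ?_⟩
    rcases eq_or_ne (weightedHausdorff d f A) ⊤ with hA | hA
    · rw [hA]
      exact (hC' A).trans (by gcongr; exact le_max_right _ _)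
    · exact (hC μ hμ A hA.lt_top).trans (by gcongr; exact le_max_left _ _)
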